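/- Let $Y$ be an inhabited set with an inequality relation $\neq$ (a symmetric relation such that $x\neq y$ implies $\lnot(x=y)$) and a symmetric relation $\bowtie$ between subsets of $Y$. For $A\subset Y$ put $\mathord{\sim}A=\{x\in Y: x\neq a \text{ for all } a\in A\}$ and $-A=\{x\in Y:\{x\}\bowtie A\}$. Suppose that $Y$ is an *apartness space*, that is, - (B1) $Y\bowtie\varnothing$; - (B2) $-A\subset\mathord{\sim}A$; - (B3) $(A_1\cup A_2)\bowtie(B_1\cup B_2)$ if and only if $A_i\bowtie B_j$ for all $i,j\in\{1,2\}$; - (B4) if $-A\subset\mathord{\sim}B$, then $-A\subset -B$; - (B5) if $x\in -A$, then there is $S\subset Y$ with $x\in -S$ and $Y=-A\cup S$. The *apartness topology* of an apartness space is the topology with base the sets $-A$; topological terms refer to it. A subset of an apartness space carries the induced inequality and the induced relation $\bowtie$. The space $2^{\mathbf N}$ of binary sequences carries the apartness of its usual uniform structure: $S\bowtie T$ if and only if there is an entourage $U$ such that $(s,t)\notin U$ for all $s\in S$, $t\in T$. A map $f$ between apartness spaces is *strongly continuous* if $f(A)\bowtie f(B)$ implies $A\bowtie B$ for all subsets $A,B$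 of its domain. An apartness space is *precompact* if there is a strongly continuous mapping of a dense subset of $2^{\mathbf N}$ onto a dense subset of it. Assume that $Y$ - is first countable: every point has a countable base of neighbourhoods; - is weakly symmetrically separated: if $S\bowtie T$, then for each $x\in Y$ there is $U\subset Y$ such that $x\in -U$ and $S\cap -U$, $T\cap -U$ are not both nonempty; - is precompact; and - has the Efremovič property: if $S\bowtie T$, then there is $E\subset Y$ such that $S\bowtie (Y\setminus E)$ and $E\bowtie T$. Let $X$ be a dense metric subspace of $Y$: a dense subset of $Y$ together with a metric $\rho$ on $X$ such that, for all $A,B\subset X$, $A\bowtie B$ if and only if there is $\varepsilon>0$ with $\rho(a,b)\ge\varepsilon$ for all $a\in A$, $b\in B$. Then the metric space $(X,\rho)$ is totally bounded, and $X$, with the apartness induced by $Y$, is precompact. -/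

import Mathlib

universe u v

/-- A (symmetric) pre-apartness on a set `X` that carries an inequality relation `ne`.
The inequality need not be tight. That the underlying set is inhabited is kept as a separate
hypothesis `Nonempty X`. -/
class PreApartnessSpace (X : Type u) where
  /-- the inequality relation -/
  ne : X → X → Prop
  ne_symm : ∀ x y, ne x y → ne y x
  not_eq_of_ne : ∀ x y, ne x y → ¬ x = y
  /-- the relation `A ⋈ B` between subsets -/
  apart : Set X → Set X → Prop
  apart_symm : ∀ A B, apart A B → apart B A
  /-- (B1) -/
  univ_apart_empty : apart Set.univ ∅
  /-- (B2): `-A ⊆ ∼A` -/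
  ne_of_apart : ∀ (A : Set X) (x : X), apart {x} A → ∀ a ∈ A, ne x a
  /-- (B3) -/
  union_apart_union : ∀ A₁ A₂ B₁ B₂ : Set X, apart (A₁ ∪ A₂) (B₁ ∪ B₂) ↔
    (apart A₁ B₁ ∧ apart A₁ B₂ ∧ apart A₂ B₁ ∧ apart A₂ B₂)
  /-- (B4): `-A ⊆ ∼B` implies `-A ⊆ -B` -/
  apart_of_compl_subset : ∀ A B : Set X,
    (∀ x, apart {x} A → ∀ b ∈ B, ne x b) → ∀ x, apart {x} A → apart {x} B

/-- An apartness space: a pre-apartness space that also satisfies (B5). -/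
class ApartnessSpace (X : Type u) extends PreApartnessSpace X where
  /-- (B5): if `x ∈ -A` then `x ∈ -S` and `X = -A ∪ S` for some `S` -/
  exists_cover : ∀ (A : Set X) (x : X), apart {x} A →
    ∃ S : Set X, apart {x} S ∧ ∀ y, apart {y} A ∨ y ∈ S

namespace PreApartnessSpace

infix:50 " ⋈ " => PreApartnessSpace.apart

/-- The apartness complement `-A`. -/
def acompl {X : Type u} [PreApartnessSpace X] (A : Set X) : Set X := {x | {x} ⋈ A}

/-- The apartness topology, generated by the apartness complements (which form a base of it, as
`-A ∩ -B = -(A ∪ B)` and `-∅ = X`). -/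
abbrev apartnessTopology (X : Type u) [PreApartnessSpace X] : TopologicalSpace X :=
  TopologicalSpace.generateFrom (Set.range (acompl : Set X → Set X))

/-- Density in the apartness topology. -/
def IsDense {X : Type u} [PreApartnessSpace X] (S : Set X) : Prop :=
  @Dense X (apartnessTopology X) S

/-- First countability of the apartness topology. -/
def FirstCountable (X : Type u) [PreApartnessSpace X] : Prop :=
  @FirstCountableTopology X (apartnessTopology X)

/-- Weak symmetric separatedness. -/
def WeaklySymmetricallySeparated (X : Type u) [PreApartnessSpace X] : Prop :=
  ∀ S T : Set X, S ⋈ T → ∀ x : X, ∃ U : Set X, x ∈ acompl U ∧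
    ¬ ((S ∩ acompl U).Nonempty ∧ (T ∩ acompl U).Nonempty)

/-- The Efremovič property. -/
def Efremovic (X : Type u) [PreApartnessSpace X] : Prop :=
  ∀ S T : Set X, S ⋈ T → ∃ E : Set X, S ⋈ Eᶜ ∧ E ⋈ T

/-- Strong continuity. -/
def StronglyContinuous {X : Type u} {Y : Type v} [PreApartnessSpace X] [PreApartnessSpace Y]
    (f : X → Y) : Prop :=
  ∀ A B : Set X, f '' A ⋈ f '' B → A ⋈ B

theorem apart_mono {X : Type u} [PreApartnessSpace X] {A A' B B' : Set X}
    (h : A ⋈ B) (hA : A' ⊆ A) (hB : B' ⊆ B) : A' ⋈ B' := by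
  have h' : (A' ∪ A) ⋈ (B' ∪ B) := by
    rwa [Set.union_eq_self_of_subset_left hA, Set.union_eq_self_of_subset_left hB]
  exact ((union_apart_union _ _ _ _).1 h').1

end PreApartnessSpace

open PreApartnessSpace

/-- (B4) follows from (B2), (B3) and (B5). -/
theorem ApartnessSpace.b4_aux {X : Type u} (ne : X → X → Prop) (apart : Set X → Set X → Prop)
    (hne : ∀ x y, ne x y → ¬ x = y)
    (mono : ∀ (x : X) (B B' : Set X), apart {x} B → B' ⊆ B → apart {x} B')
    (b5 : ∀ (A : Set X) (x : X), apart {x} A →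
      ∃ S : Set X, apart {x} S ∧ ∀ y, apart {y} A ∨ y ∈ S)
    (A B : Set X) (h : ∀ x, apart {x} A → ∀ b ∈ B, ne x b) (x : X) (hx : apart {x} A) :
    apart {x} B := by
  obtain ⟨S, hS, hc⟩ := b5 A x hx
  refine mono x S B hS fun b hb => ?_
  rcases hc b with h1 | h1
  · exact absurd rfl (hne _ _ (h b h1 b hb))
  · exact h1

/-- A subset of an apartness space, with the induced inequality and the induced apartness. -/
instance ApartnessSpace.subspace {X : Type u} [ApartnessSpace X] (S : Set X) :
    ApartnessSpace S :=
  have mono : ∀ (x : S) (B B' : Set S),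
      ((↑) '' ({x} : Set S) : Set X) ⋈ ((↑) '' B : Set X) → B' ⊆ B →
      ((↑) '' ({x} : Set S) : Set X) ⋈ ((↑) '' B' : Set X) := fun _ _ _ h hB =>
    apart_mono h subset_rfl (Set.image_mono hB)
  have b5 : ∀ (A : Set S) (x : S), ((↑) '' ({x} : Set S) : Set X) ⋈ ((↑) '' A : Set X) →
      ∃ T : Set S, ((↑) '' ({x} : Set S) : Set X) ⋈ ((↑) '' T : Set X) ∧
        ∀ y : S, ((↑) '' ({y} : Set S) : Set X) ⋈ ((↑) '' A : Set X) ∨ y ∈ T := by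
    intro A x h
    simp only [Set.image_singleton] at h ⊢
    obtain ⟨T, hT, hc⟩ := ApartnessSpace.exists_cover _ _ h
    exact ⟨{y | (y : X) ∈ T}, apart_mono hT subset_rfl (by rintro _ ⟨y, hy, rfl⟩; exact hy),
      fun y => hc y⟩
  { ne := fun x y => ne (x : X) (y : X)
    ne_symm := fun x y h => ne_symm _ _ h
    not_eq_of_ne := fun x y h hxy => not_eq_of_ne _ _ h (congrArg _ hxy)
    apart := fun A B => ((↑) '' A : Set X) ⋈ ((↑) '' B : Set X)
    apart_symm := fun A B h => apart_symm _ _ h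
    univ_apart_empty := by
      exact apart_mono univ_apart_empty (Set.subset_univ _) (by simp)
    ne_of_apart := fun A x h a ha => by
      rw [Set.image_singleton] at h
      exact ne_of_apart _ _ h _ (Set.mem_image_of_mem _ ha)
    union_apart_union := fun A₁ A₂ B₁ B₂ => by
      simp only [Set.image_union]
      exact union_apart_union _ _ _ _
    apart_of_compl_subset := ApartnessSpace.b4_aux
      (fun x y : S => ne (x : X) (y : X)) (fun A B : Set S => ((↑) '' A : Set X) ⋈ ((↑) '' B : Set X))
      (fun x y h hxy => not_eq_of_ne _ _ h (congrArg _ hxy)) mono b5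
    exists_cover := b5 }

/-- The apartness of a uniform space: `S ⋈ T` if and only if `S × T` lies outside some
entourage. -/
abbrev ApartnessSpace.ofUniformSpace (X : Type u) [UniformSpace X] : ApartnessSpace X :=
  have b5 : ∀ (A : Set X) (x : X),
      (∃ U ∈ uniformity X, ∀ s ∈ ({x} : Set X), ∀ t ∈ A, (s, t) ∉ U) →
      ∃ S : Set X, (∃ U ∈ uniformity X, ∀ s ∈ ({x} : Set X), ∀ t ∈ S, (s, t) ∉ U) ∧
        ∀ y, (∃ U ∈ uniformity X, ∀ s ∈ ({y} : Set X), ∀ t ∈ A, (s, t) ∉ U) ∨ y ∈ S := by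
    rintro A x ⟨U, hU, h⟩
    obtain ⟨V, hV, hVU⟩ := comp_mem_uniformity_sets hU
    refine ⟨{y | (x, y) ∉ V}, ⟨V, hV, ?_⟩, fun y => ?_⟩
    · rintro s rfl t ht
      exact ht
    · by_cases hy : (x, y) ∈ V
      · refine Or.inl ⟨V, hV, ?_⟩
        rintro s rfl t ht hst
        exact h x rfl t ht (hVU ⟨s, hy, hst⟩)
      · exact Or.inr hy
  have hne : ∀ x y : X, (∃ U ∈ uniformity X, (x, y) ∉ U) → ¬ x = y := by
    rintro x y ⟨U, hU, h⟩ rfl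
    exact h (refl_mem_uniformity hU)
  { ne := fun x y => ∃ U ∈ uniformity X, (x, y) ∉ U
    ne_symm := by
      rintro x y ⟨U, hU, h⟩
      exact ⟨_, symm_le_uniformity hU, h⟩
    not_eq_of_ne := hne
    apart := fun S T => ∃ U ∈ uniformity X, ∀ s ∈ S, ∀ t ∈ T, (s, t) ∉ U
    apart_symm := by
      rintro A B ⟨U, hU, h⟩
      exact ⟨_, symm_le_uniformity hU, fun b hb a ha => h a ha b hb⟩
    univ_apart_empty := ⟨Set.univ, Filter.univ_mem, by simp⟩
    ne_of_apart := by
      rintro A x ⟨U, hU, h⟩ a ha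
      exact ⟨U, hU, h x rfl a ha⟩
    union_apart_union := by
      intro A₁ A₂ B₁ B₂
      constructor
      · rintro ⟨U, hU, h⟩
        exact ⟨⟨U, hU, fun s hs t ht => h s (Or.inl hs) t (Or.inl ht)⟩,
          ⟨U, hU, fun s hs t ht => h s (Or.inl hs) t (Or.inr ht)⟩,
          ⟨U, hU, fun s hs t ht => h s (Or.inr hs) t (Or.inl ht)⟩,
          ⟨U, hU, fun s hs t ht => h s (Or.inr hs) t (Or.inr ht)⟩⟩
      · rintro ⟨⟨U, hU, h⟩, ⟨U', hU', h'⟩, ⟨V, hV, k⟩, ⟨V', hV', k'⟩⟩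
        refine ⟨(U ∩ U') ∩ (V ∩ V'),
          Filter.inter_mem (Filter.inter_mem hU hU') (Filter.inter_mem hV hV'), ?_⟩
        rintro s (hs | hs) t (ht | ht) ⟨⟨a, b⟩, c, d⟩
        · exact h s hs t ht a
        · exact h' s hs t ht b
        · exact k s hs t ht c
        · exact k' s hs t ht d
    apart_of_compl_subset := ApartnessSpace.b4_aux _
      (fun S T => ∃ U ∈ uniformity X, ∀ s ∈ S, ∀ t ∈ T, (s, t) ∉ U) hne
      (by
        rintro x B B' ⟨U, hU, h⟩ hB
        exact ⟨U, hU, fun s hs t ht => h s hs t (hB ht)⟩) b5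
    exists_cover := b5 }

/-- The space `2^ℕ` of binary sequences, with the apartness of its (product) uniform structure. -/
instance cantorApartnessSpace : ApartnessSpace (ℕ → Bool) :=
  ApartnessSpace.ofUniformSpace (ℕ → Bool)

/-- `X` is precompact: there is a strongly continuous mapping of a dense subset of `2^ℕ` onto a
dense subset of `X`. -/
def ApartnessSpace.Precompact (X : Type u) [ApartnessSpace X] : Prop :=
  ∃ D : Set (ℕ → Bool), IsDense D ∧
    ∃ h : D → X, StronglyContinuous h ∧ IsDense (Set.range h)

/-- The subset `X` of `Y` is a metric subspace with respect to the metric `ρ` on `X`: the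
apartness that `Y` induces on `X` is the apartness `∃ ε > 0, ∀ a ∈ A, ∀ b ∈ B, ρ(a, b) ≥ ε`
given by the metric. -/
def ApartnessSpace.IsMetricSubspace {Y : Type u} [ApartnessSpace Y] (X : Set Y)
    (ρ : MetricSpace X) : Prop :=
  ∀ A B : Set X, A ⋈ B ↔ ∃ ε > 0, ∀ a ∈ A, ∀ b ∈ B, ε ≤ ρ.dist a b

/-!
Write `A δ B` ("near") for the negation of `A ⋈ B`.

*Total boundedness.* Otherwise `X` contains a sequence `x n` with mutual distances at least `ε`. The
balls `B n` of radius `ε / 4` around the `x n` are then so far from each other that, for every set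
`S` of indices, `⋃ n ∈ S, B n` and `⋃ n ∉ S, B n` are apart. Let `h : D → Y` witness that `Y` is
precompact. Each `-(X \ B n)` is a neighbourhood of `x n`, so it contains a point `h (d n)`; as `X`
is dense, this point is near `B n` (`notMem_acompl_of_mem_acompl_diff`). In an Efremovič space apart
sets have apart closures (`Efremovic.compl_acompl_apart`), so `{h (d n) | n ∈ S}` and
`{h (d n) | n ∉ S}` are apart, and by strong continuity so are `{d n | n ∈ S}` and `{d n | n ∉ S}`,
for every `S`. This is impossible in the compact space `2^ℕ`: take for `S` every second index of a
convergent subsequence (`exists_not_apart_image`).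

*Precompactness.* A nonempty totally bounded `X` receives a uniformly continuous map with dense range
from the eventually zero binary sequences (`exists_uniform_dense_map`). Such a sequence, read as an
`ℕ × ℕ` array of bits, steers a walk through finite nets of mesh `R / 2 ^ k`: row `k` names a point
of the `k`-th net, and the walk moves there if the distance is at most three times the mesh. The
walk converges geometrically, and since it comes to rest after finitely many steps its limit lies in
`X`, with no completeness needed.
-/

/-! ### Apartness complements, density and nearness -/

namespace PreApartnessSpace

section Basic

variable {Y : Type*} [PreApartnessSpace Y]

theorem notMem_of_mem_acompl {A : Set Y} {x : Y} (h : x ∈ acompl A) : x ∉ A := fun hx =>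
  not_eq_of_ne _ _ (ne_of_apart A x h x hx) rfl

theorem acompl_anti {A B : Set Y} (h : A ⊆ B) : acompl B ⊆ acompl A := fun _ hx =>
  apart_mono hx subset_rfl h

theorem mem_acompl_union {A B : Set Y} {x : Y} (hA : x ∈ acompl A) (hB : x ∈ acompl B) :
    x ∈ acompl (A ∪ B) := by
  have h := (union_apart_union {x} {x} A B).2 ⟨hA, hB, hA, hB⟩
  rwa [Set.union_self] at h

theorem mem_acompl_empty (x : Y) : x ∈ acompl (∅ : Set Y) :=
  apart_mono univ_apart_empty (Set.subset_univ _) subset_rfl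

theorem exists_acompl_subset_of_isOpen {U : Set Y} (hU : @IsOpen Y (apartnessTopology Y) U) {x : Y}
    (hx : x ∈ U) : ∃ A : Set Y, x ∈ acompl A ∧ acompl A ⊆ U := by
  induction hU with
  | basic s hs =>
    obtain ⟨A, rfl⟩ := hs
    exact ⟨A, hx, subset_rfl⟩
  | univ => exact ⟨∅, mem_acompl_empty x, Set.subset_univ _⟩
  | inter s t _ _ ihs iht =>
    obtain ⟨A, hA, hAs⟩ := ihs hx.1
    obtain ⟨B, hB, hBt⟩ := iht hx.2
    exact ⟨A ∪ B, mem_acompl_union hA hB, fun y hy =>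
      ⟨hAs (acompl_anti Set.subset_union_left hy), hBt (acompl_anti Set.subset_union_right hy)⟩⟩
  | sUnion S _ ih =>
    obtain ⟨s, hs, hxs⟩ := hx
    obtain ⟨A, hA, hAs⟩ := ih s hs hxs
    exact ⟨A, hA, hAs.trans (Set.subset_sUnion_of_mem hs)⟩

theorem isDense_iff {S : Set Y} :
    IsDense S ↔ ∀ (A : Set Y) (x : Y), x ∈ acompl A → ∃ s ∈ S, s ∈ acompl A := by
  let _ := apartnessTopology Y
  constructor
  · intro h A x hx
    obtain ⟨s, hsA, hs⟩ := h.inter_open_nonempty (acompl A)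
      (TopologicalSpace.isOpen_generateFrom_of_mem ⟨A, rfl⟩) ⟨x, hx⟩
    exact ⟨s, hs, hsA⟩
  · intro h
    refine dense_iff_inter_open.2 ?_
    rintro U hU ⟨x, hx⟩
    obtain ⟨A, hA, hAU⟩ := exists_acompl_subset_of_isOpen hU hx
    obtain ⟨s, hs, hsA⟩ := h A x hA
    exact ⟨s, hAU hsA, hs⟩

theorem IsDense.acompl_eq_empty {S : Set Y} (hS : IsDense S) : acompl S = ∅ := by
  refine Set.eq_empty_iff_forall_notMem.2 fun x hx => ?_
  obtain ⟨s, hs, hs'⟩ := isDense_iff.1 hS S x hx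
  exact notMem_of_mem_acompl hs' hs

/-- In an Efremovič space, apartness of two sets passes to their closures: the complement of
`acompl P` is the set of points that are near `P`. -/
theorem Efremovic.compl_acompl_apart (hY : Efremovic Y) {P Q : Set Y} (h : P ⋈ Q) :
    (acompl P)ᶜ ⋈ (acompl Q)ᶜ := by
  have key : ∀ {P Q : Set Y}, P ⋈ Q → P ⋈ (acompl Q)ᶜ := by
    intro P Q h
    obtain ⟨E, hPE, hEQ⟩ := hY P Q h
    refine apart_mono hPE subset_rfl (Set.compl_subset_compl.2 fun y hy => ?_)
    exact apart_mono hEQ (Set.singleton_subset_iff.2 hy) subset_rfl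
  exact apart_symm _ _ (key (apart_symm _ _ (key h)))

end Basic

end PreApartnessSpace

/-! ### Total boundedness of dense metric subspaces -/

namespace ApartnessSpace

section TotallyBounded

/-- A sequence in a subset of `2^ℕ` cannot have all its subfamilies apart from the complementary
ones: by compactness of `2^ℕ` it has a Cauchy subsequence, whose even terms are near the odd ones. -/
theorem exists_not_apart_image {D : Set (ℕ → Bool)} (d : ℕ → D) :
    ∃ S : Set ℕ, ¬ (d '' S) ⋈ (d '' Sᶜ) := by
  obtain ⟨c, φ, hφ, hc⟩ := CompactSpace.tendsto_subseq fun n => (d n : ℕ → Bool)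
  refine ⟨Set.range fun k => φ (2 * k), ?_⟩
  rintro ⟨U, hU, h⟩
  obtain ⟨n, hn⟩ := Filter.eventually_atTop.1
    ((hc.cauchySeq.eventually_eventually hU))
  obtain ⟨m, hm⟩ := Filter.eventually_atTop.1 (hn (2 * n) (by omega))
  refine h _ ⟨_, ⟨_, ⟨n, rfl⟩, rfl⟩, rfl⟩ _ ⟨_, ⟨φ (2 * m + 1), ?_, rfl⟩, rfl⟩
    (hm (2 * m + 1) (by omega))
  rintro ⟨k, hk⟩
  have := hφ.injective hk
  omega

/-- For `X` dense, the open set `-(X \ B)` consists of points near `B`: the apartness complement of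
`(X \ B) ∪ B ⊇ X` is empty. -/
theorem notMem_acompl_of_mem_acompl_diff {Y : Type*} [PreApartnessSpace Y] {X B : Set Y}
    (hX : IsDense X) {y : Y} (hy : y ∈ acompl (X \ B)) : y ∉ acompl B := fun hyB => by
  have h' : y ∈ acompl X :=
    acompl_anti (by rw [Set.sdiff_union_self]; exact Set.subset_union_left)
      (mem_acompl_union hy hyB)
  rw [hX.acompl_eq_empty] at h'
  exact h'

/-- A failure of total boundedness gives an `ε`-separated sequence `x n` in `X`, so the union of the
balls of radius `ε / 4` over any set of indices is apart from the union over the others. Points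
`h (d n)` of the image of `2^ℕ` near these balls inherit this by the Efremovič property, and strong
continuity carries it back to the sequence `d n`, where it contradicts compactness. -/
theorem IsMetricSubspace.totallyBounded {Y : Type*} [ApartnessSpace Y]
    (hpre : Precompact Y) (hef : Efremovic Y) {X : Set Y} (hX : IsDense X)
    {ρ : MetricSpace X} (hρ : IsMetricSubspace X ρ) :
    TotallyBounded (Set.univ : Set X) := by
  obtain ⟨D, -, h, hcont, hdense⟩ := hpre
  refine Metric.totallyBounded_iff.2 ?_
  by_contra! hcon
  obtain ⟨ε, hε, hnot⟩ := hcon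
  obtain ⟨x, hx⟩ : ∃ x : ℕ → X, ∀ n m, m < n → ε ≤ dist (x n) (x m) := by
    have key : ∀ t : Set X, t.Finite → ∃ z : X, ∀ w ∈ t, ε ≤ dist z w := by
      intro t ht
      obtain ⟨z, -, hz⟩ := Set.not_subset.1 (hnot t ht)
      refine ⟨z, fun w hw => ?_⟩
      by_contra hlt
      exact hz (Set.mem_biUnion hw (Metric.mem_ball.2 (not_le.1 hlt)))
    obtain ⟨x, hx⟩ := Set.seq_of_forall_finite_exists key
    exact ⟨x, fun n m hmn => hx n _ (Set.mem_image_of_mem x hmn)⟩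
  have hsep : ∀ n m, n ≠ m → ε ≤ dist (x n) (x m) := by
    intro n m hnm
    rcases hnm.lt_or_gt with hlt | hlt
    · rw [dist_comm]
      exact hx m n hlt
    · exact hx n m hlt
  let B : ℕ → Set X := fun n => Metric.ball (x n) (ε / 4)
  -- Approximate each `x n` by a point of the dense image of `h`.
  have happ : ∀ n, ∃ d : D, h d ∈ acompl (X \ ((↑) '' B n : Set Y)) := by
    intro n
    have hmem : (x n : Y) ∈ acompl (X \ ((↑) '' B n : Set Y)) := by
      have hap : ({x n} : Set X) ⋈ (B n)ᶜ := by
        refine (hρ _ _).2 ⟨ε / 4, by positivity, ?_⟩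
        rintro a rfl b hb
        rw [dist_comm]
        exact not_lt.1 hb
      refine apart_mono (show ((↑) '' ({x n} : Set X) : Set Y) ⋈ ((↑) '' (B n)ᶜ : Set Y) from hap)
        (by simp) ?_
      rintro y ⟨hyX, hyB⟩
      exact ⟨⟨y, hyX⟩, fun hy => hyB ⟨_, hy, rfl⟩, rfl⟩
    obtain ⟨_, ⟨d, rfl⟩, hd⟩ := isDense_iff.1 hdense _ _ hmem
    exact ⟨d, hd⟩
  choose d hd using happ
  -- The points `h (d n)`, `n ∈ S`, will be apart from the `h (d n)`, `n ∉ S`; the `d n` are not.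
  obtain ⟨S, hS⟩ := exists_not_apart_image d
  refine hS (hcont _ _ ?_)
  have hballs : ((↑) '' (⋃ n ∈ S, B n) : Set Y) ⋈ ((↑) '' (⋃ n ∈ Sᶜ, B n) : Set Y) := by
    refine (hρ _ _).2 ⟨ε / 2, by positivity, fun a ha b hb => ?_⟩
    simp only [Set.mem_iUnion] at ha hb
    obtain ⟨n, hn, ha⟩ := ha
    obtain ⟨m, hm, hb⟩ := hb
    have hnm := hsep n m (by rintro rfl; exact hm hn)
    have h1 := dist_triangle4 (x n) a b (x m)
    have h2 : dist (x n) a < ε / 4 := Metric.mem_ball'.1 ha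
    have h3 : dist b (x m) < ε / 4 := Metric.mem_ball.1 hb
    linarith
  have hnear : ∀ T : Set ℕ, h '' (d '' T) ⊆ (acompl ((↑) '' (⋃ n ∈ T, B n) : Set Y))ᶜ := by
    rintro T _ ⟨_, ⟨n, hn, rfl⟩, rfl⟩ hmem
    exact notMem_acompl_of_mem_acompl_diff hX (hd n)
      (acompl_anti (Set.image_mono (Set.subset_biUnion_of_mem (u := B) hn)) hmem)
  exact apart_mono (hef.compl_acompl_apart hballs) (hnear S) (hnear Sᶜ)

end TotallyBounded

end ApartnessSpace

/-! ### Mapping eventually zero binary sequences onto a dense subset -/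

section CantorScheme

variable {X : Type*} [MetricSpace X]

/-- One step of the walk through the nets `a 0, …, a (N - 1)`: if one of the bits `b j`, `j < N`,
asks for a net point `a j` within distance `r` of the current position `x`, move to such a point,
otherwise stay. -/
noncomputable def netStep (a : ℕ → X) (N : ℕ) (r : ℝ) (b : ℕ → Bool) (x : X) : X :=
  open Classical in
  if h : ∃ y, ∃ j < N, b j = true ∧ a j = y ∧ dist x y ≤ r then h.choose else x

section NetStep

variable {a : ℕ → X} {N : ℕ} {r : ℝ} {b b' : ℕ → Bool} {x : X}

theorem dist_netStep_le (hr : 0 ≤ r) : dist x (netStep a N r b x) ≤ r := by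
  unfold netStep
  split_ifs with h
  · obtain ⟨j, -, -, -, hj⟩ := h.choose_spec
    exact hj
  · simpa using hr

theorem netStep_of_forall_false (h : ∀ j < N, b j = false) : netStep a N r b x = x := by
  unfold netStep
  rw [dif_neg]
  rintro ⟨y, j, hj, hb, -⟩
  simp [h j hj] at hb

theorem netStep_congr (h : ∀ j < N, b j = b' j) : netStep a N r b x = netStep a N r b' x := by
  classical
  have : (fun y => ∃ j < N, b j = true ∧ a j = y ∧ dist x y ≤ r) =
      fun y => ∃ j < N, b' j = true ∧ a j = y ∧ dist x y ≤ r := by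
    funext y
    refine propext (exists_congr fun j => and_congr_right fun hj => ?_)
    rw [h j hj]
  have key : ∀ P Q : X → Prop, P = Q → ∀ [Decidable (∃ y, P y)] [Decidable (∃ y, Q y)],
      (if h : ∃ y, P y then h.choose else x) = if h : ∃ y, Q y then h.choose else x := by
    rintro P _ rfl _ _
    congr
  exact key _ _ this

theorem netStep_eq {c : ℕ} (hc : c < N) (hb : ∀ j < N, b j = true ↔ j = c)
    (hx : dist x (a c) ≤ r) : netStep a N r b x = a c := by
  have h : ∃ y, ∃ j < N, b j = true ∧ a j = y ∧ dist x y ≤ r :=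
    ⟨a c, c, hc, (hb c hc).2 rfl, rfl, hx⟩
  unfold netStep
  rw [dif_pos h]
  obtain ⟨j, hj, hbj, haj, -⟩ := h.choose_spec
  rw [← haj, (hb j hj).1 hbj]

end NetStep

/-- The walk from `x₀` steered by a binary sequence `d`: step `k` goes through the `k`-th net
`a k 0, …, a k (N k - 1)`, reads row `k` of `d` under the pairing `ℕ × ℕ ≃ ℕ`, and covers
a distance of at most `3 * r k`. -/
noncomputable def netWalk (a : ℕ → ℕ → X) (N : ℕ → ℕ) (r : ℕ → ℝ) (x₀ : X) (d : ℕ → Bool) : ℕ → X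
  | 0 => x₀
  | k + 1 => netStep (a k) (N k) (3 * r k) (fun j => d (Nat.pair k j)) (netWalk a N r x₀ d k)

section NetWalk

variable {a : ℕ → ℕ → X} {N : ℕ → ℕ} {r : ℕ → ℝ} {x₀ : X} {d : ℕ → Bool}

theorem netWalk_eq_of_le {n m : ℕ} (hd : ∀ i ≥ n, d i = false) (hnm : n ≤ m) :
    netWalk a N r x₀ d m = netWalk a N r x₀ d n := by
  induction m, hnm using Nat.le_induction with
  | base => rfl
  | succ m hm ih =>
    rw [netWalk, netStep_of_forall_false, ih]
    exact fun j _ => hd _ (hm.trans (Nat.left_le_pair m j))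

/-- After time `k` the walk stays within `6 * r k` of its position, since its later steps are bounded
by the geometric series `3 * r k + 3 * r (k + 1) + ⋯`. -/
theorem dist_netWalk_le (hr : ∀ k, 0 ≤ r k) (hr2 : ∀ k, r k = 2 * r (k + 1)) {k m : ℕ}
    (hkm : k ≤ m) :
    dist (netWalk a N r x₀ d k) (netWalk a N r x₀ d m) ≤ 6 * r k := by
  suffices h : dist (netWalk a N r x₀ d k) (netWalk a N r x₀ d m) ≤ 6 * r k - 6 * r m by
    linarith [hr m]
  -- Subtracting `6 * r m`, the bound on the steps still to come, makes the induction close.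
  induction m, hkm using Nat.le_induction with
  | base => simp
  | succ m hm ih =>
    have h1 : dist (netWalk a N r x₀ d m) (netWalk a N r x₀ d (m + 1)) ≤ 3 * r m :=
      dist_netStep_le (by linarith [hr m])
    have h2 := dist_triangle (netWalk a N r x₀ d k) (netWalk a N r x₀ d m)
      (netWalk a N r x₀ d (m + 1))
    linarith [hr2 m]

/-- The `k`-th position of the walk depends only on finitely many bits of the steering sequence. -/
theorem exists_netWalk_congr (a : ℕ → ℕ → X) (N : ℕ → ℕ) (r : ℕ → ℝ) (x₀ : X) (k : ℕ) :
    ∃ M, ∀ d d' : ℕ → Bool, (∀ i < M, d i = d' i) →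
      netWalk a N r x₀ d k = netWalk a N r x₀ d' k := by
  induction k with
  | zero => exact ⟨0, fun _ _ _ => rfl⟩
  | succ k ih =>
    obtain ⟨M, hM⟩ := ih
    refine ⟨max M (Nat.pair k (N k)), fun d d' h => ?_⟩
    rw [netWalk, netWalk, hM d d' fun i hi => h i (lt_max_of_lt_left hi)]
    exact netStep_congr fun j hj => h _ (lt_max_of_lt_right (Nat.pair_lt_pair_right k hj))

/-- The walk can be steered by an eventually zero sequence to within `2 * r K` of any given `x`: let
row `k < K` ask for a net point that is `r k`-close to `x`. This point is in reach, as the walk is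
within `2 * r k` of `x` when step `k` begins. -/
theorem exists_dist_netWalk_le (hr2 : ∀ k, r k = 2 * r (k + 1)) (hr : ∀ k, 0 ≤ r k)
    (hnet : ∀ k x, ∃ j < N k, dist x (a k j) ≤ r k) (hx₀ : ∀ x, dist x₀ x ≤ r 0) (x : X) (K : ℕ) :
    ∃ d : ℕ → Bool, (∀ᶠ i in Filter.atTop, d i = false) ∧
      dist (netWalk a N r x₀ d K) x ≤ 2 * r K := by
  choose c hcN hc using fun k => hnet k x
  let d : ℕ → Bool := fun i => decide (i.unpair.1 < K ∧ i.unpair.2 = c i.unpair.1)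
  refine ⟨d, ?_, ?_⟩
  · have hfin : {i | d i = true}.Finite := by
      refine ((Set.finite_lt_nat K).image fun k => Nat.pair k (c k)).subset fun i hi => ?_
      obtain ⟨h1, h2⟩ := of_decide_eq_true hi
      refine ⟨i.unpair.1, h1, ?_⟩
      change Nat.pair i.unpair.1 (c i.unpair.1) = i
      rw [← h2, Nat.pair_unpair]
    rw [← Nat.cofinite_eq_atTop]
    simpa [Filter.eventually_cofinite] using hfin
  · suffices h : ∀ k ≤ K, dist (netWalk a N r x₀ d k) x ≤ 2 * r k from h K le_rfl
    intro k
    induction k with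
    | zero => exact fun _ => (hx₀ x).trans (by linarith [hr 0])
    | succ k ih =>
      intro hk
      have hstep : netWalk a N r x₀ d (k + 1) = a k (c k) := by
        refine netStep_eq (hcN k) (fun j _ => ?_) ?_
        · simp only [d, Nat.unpair_pair, decide_eq_true_eq]
          exact and_iff_right hk
        · linarith [dist_triangle (netWalk a N r x₀ d k) x (a k (c k)), ih (by omega), hc k]
      rw [hstep, dist_comm, ← hr2 k]
      exact hc k

end NetWalk

/-- A totally bounded space has finite nets `a k 0, …, a k (N k - 1)` of geometrically decreasing
mesh `R * (1 / 2) ^ k`, where `R` bounds the distances from `x₀`. -/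
theorem exists_nets (hX : TotallyBounded (Set.univ : Set X)) (x₀ : X) :
    ∃ (a : ℕ → ℕ → X) (N : ℕ → ℕ) (R : ℝ), 0 < R ∧ (∀ x, dist x₀ x ≤ R) ∧
      ∀ k x, ∃ j < N k, dist x (a k j) ≤ R * (1 / 2) ^ k := by
  obtain ⟨R, hR0, hR⟩ : ∃ R : ℝ, 0 < R ∧ ∀ x, dist x₀ x ≤ R := by
    obtain ⟨C, hC⟩ := Metric.isBounded_iff.1 hX.isBounded
    refine ⟨max C 1, by positivity, fun x => (hC trivial trivial).trans (le_max_left _ _)⟩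
  have key : ∀ k : ℕ, ∃ (a : ℕ → X) (N : ℕ), ∀ x, ∃ j < N, dist x (a j) ≤ R * (1 / 2) ^ k := by
    intro k
    obtain ⟨t, ht, hcov⟩ := Metric.totallyBounded_iff.1 hX (R * (1 / 2) ^ k) (by positivity)
    refine ⟨fun j => ht.toFinset.toList.getD j x₀, ht.toFinset.toList.length, fun x => ?_⟩
    obtain ⟨y, hy, hxy⟩ := Set.mem_iUnion₂.1 (hcov (Set.mem_univ x))
    obtain ⟨j, hj, rfl⟩ := List.mem_iff_getElem.1 (Finset.mem_toList.2 (ht.mem_toFinset.2 hy))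
    refine ⟨j, hj, ?_⟩
    change dist x (ht.toFinset.toList.getD j x₀) ≤ _
    rw [List.getD_eq_getElem _ _ hj]
    exact (Metric.mem_ball.1 hxy).le
  choose a N hN using key
  exact ⟨a, N, R, hR0, hR, hN⟩

/-- The eventually zero binary sequences map onto a dense subset of any nonempty totally bounded
metric space by a uniformly continuous map. -/
theorem exists_uniform_dense_map (hX : TotallyBounded (Set.univ : Set X)) [Nonempty X] :
    ∃ h : {d : ℕ → Bool | ∀ᶠ i in Filter.atTop, d i = false} → X,
      (∀ ε > 0, ∃ M : ℕ, ∀ d d' : {d : ℕ → Bool | ∀ᶠ i in Filter.atTop, d i = false},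
        (∀ i < M, d.1 i = d'.1 i) → dist (h d) (h d') < ε) ∧
      ∀ x, ∀ ε > 0, ∃ d, dist x (h d) < ε := by
  obtain ⟨x₀⟩ := ‹Nonempty X›
  obtain ⟨a, N, R, hR, hx₀, hnet⟩ := exists_nets hX x₀
  set r : ℕ → ℝ := fun k => R * (1 / 2) ^ k with hrdef
  have hr : ∀ k, 0 ≤ r k := fun k => by positivity
  have hr2 : ∀ k, r k = 2 * r (k + 1) := fun k => by simp only [hrdef, pow_succ]; ring
  have hsmall : ∀ ε > 0, ∃ k, 12 * r k < ε := by
    intro ε hε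
    obtain ⟨k, hk⟩ := exists_pow_lt_of_lt_one (show 0 < ε / (12 * R) by positivity)
      (show (1 / 2 : ℝ) < 1 by norm_num)
    refine ⟨k, ?_⟩
    rw [lt_div_iff₀ (by positivity)] at hk
    calc 12 * r k = (1 / 2) ^ k * (12 * R) := by simp only [hrdef]; ring
      _ < ε := hk
  choose n hn using fun d : {d : ℕ → Bool | ∀ᶠ i in Filter.atTop, d i = false} =>
    Filter.eventually_atTop.1 d.2
  -- The walk of an eventually zero sequence comes to rest, so its limit is a point of `X` itself.
  let h : {d : ℕ → Bool | ∀ᶠ i in Filter.atTop, d i = false} → X :=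
    fun d => netWalk a N r x₀ d.1 (n d)
  have hh : ∀ d k, dist (netWalk a N r x₀ d.1 k) (h d) ≤ 6 * r k := by
    intro d k
    have h1 : h d = netWalk a N r x₀ d.1 (max k (n d)) :=
      (netWalk_eq_of_le (hn d) (le_max_right _ _)).symm
    rw [h1]
    exact dist_netWalk_le hr hr2 (le_max_left _ _)
  refine ⟨h, fun ε hε => ?_, fun x ε hε => ?_⟩
  · obtain ⟨k, hk⟩ := hsmall ε hε
    obtain ⟨M, hM⟩ := exists_netWalk_congr a N r x₀ k
    refine ⟨M, fun d d' hdd => ?_⟩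
    have h1 := hh d k
    rw [hM _ _ hdd] at h1
    linarith [dist_triangle_left (h d) (h d') (netWalk a N r x₀ d'.1 k), hh d' k]
  · obtain ⟨k, hk⟩ := hsmall ε hε
    obtain ⟨d, hd, hdx⟩ := exists_dist_netWalk_le hr2 hr hnet (fun x => by simpa [hrdef] using hx₀ x)
      x k
    refine ⟨⟨d, hd⟩, ?_⟩
    linarith [dist_triangle_left x (h ⟨d, hd⟩) (netWalk a N r x₀ d k), hh ⟨d, hd⟩ k, hr k]

end CantorScheme

/-! ### Precompactness of totally bounded metric subspaces -/

namespace ApartnessSpace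

section Precompact

theorem setOf_agree_mem_uniformity (M : ℕ) :
    {p : (ℕ → Bool) × (ℕ → Bool) | ∀ i < M, p.1 i = p.2 i} ∈ uniformity (ℕ → Bool) := by
  have h : ∀ i : ℕ, {p : (ℕ → Bool) × (ℕ → Bool) | p.1 i = p.2 i} ∈ uniformity (ℕ → Bool) :=
    fun i => Pi.uniformContinuous_proj (fun _ : ℕ => Bool) i
      (DiscreteUniformity.relId_mem_uniformity (X := Bool))
  have h' := (Filter.biInter_mem (Set.finite_lt_nat M)).2 fun i _ => h i
  refine Filter.mem_of_superset h' fun p hp i hi => ?_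
  exact Set.mem_iInter₂.1 hp i hi

theorem isDense_of_dense {D : Set (ℕ → Bool)} (hD : Dense D) : IsDense D := by
  refine isDense_iff.2 ?_
  rintro A x ⟨U, hU, h⟩
  obtain ⟨V, hV, hVU⟩ := comp_mem_uniformity_sets hU
  obtain ⟨s, hsV, hs⟩ := mem_closure_iff_nhds.1 (hD x) _ (UniformSpace.ball_mem_nhds x hV)
  refine ⟨s, hs, V, hV, ?_⟩
  rintro _ rfl t ht hst
  exact h x rfl t ht (hVU ⟨_, hsV, hst⟩)

theorem dense_eventually_false :
    Dense {d : ℕ → Bool | ∀ᶠ i in Filter.atTop, d i = false} := by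
  intro x
  refine mem_closure_of_tendsto (f := fun n i => if i < n then x i else false)
    (b := Filter.atTop) ?_ (Filter.Eventually.of_forall fun n => ?_)
  · refine tendsto_pi_nhds.2 fun i => tendsto_const_nhds.congr' ?_
    filter_upwards [Filter.eventually_gt_atTop i] with n hn
    exact (if_pos hn).symm
  · filter_upwards [Filter.eventually_ge_atTop n] with i hi
    exact if_neg (not_lt.2 hi)

/-- A nonempty totally bounded metric subspace is precompact: for the apartness given by the
metric, uniform continuity of the walk map yields strong continuity, and metric density yields
density in the apartness topology. -/
theorem IsMetricSubspace.precompact {Y : Type*} [ApartnessSpace Y] {X : Set Y} [Nonempty X]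
    {ρ : MetricSpace X} (hρ : IsMetricSubspace X ρ) (hX : TotallyBounded (Set.univ : Set X)) :
    Precompact X := by
  obtain ⟨h, hcont, hdense⟩ := exists_uniform_dense_map hX
  refine ⟨_, isDense_of_dense dense_eventually_false, h, fun A B hAB => ?_, ?_⟩
  · obtain ⟨ε, hε, hAB⟩ := (hρ _ _).1 hAB
    obtain ⟨M, hM⟩ := hcont ε hε
    refine ⟨_, setOf_agree_mem_uniformity M, ?_⟩
    rintro _ ⟨d, hd, rfl⟩ _ ⟨d', hd', rfl⟩ hagree
    exact (hM d d' hagree).not_ge (hAB _ ⟨d, hd, rfl⟩ _ ⟨d', hd', rfl⟩)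
  · refine isDense_iff.2 fun A x hx => ?_
    obtain ⟨ε, hε, hxA⟩ := (hρ _ _).1 hx
    obtain ⟨d, hd⟩ := hdense x (ε / 2) (by positivity)
    refine ⟨h d, ⟨d, rfl⟩, (hρ _ _).2 ⟨ε / 2, by positivity, ?_⟩⟩
    rintro _ rfl b hb
    linarith [dist_triangle x (h d) b, hxA x rfl b hb]

end Precompact

end ApartnessSpace

theorem corollary2p10 {Y : Type u} [Nonempty Y] [ApartnessSpace Y]
    (hfc : FirstCountable Y) (hwss : WeaklySymmetricallySeparated Y)
    (hpre : ApartnessSpace.Precompact Y) (hef : Efremovic Y)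
    (X : Set Y) (hX : IsDense X)
    (ρ : MetricSpace X) (hρ : ApartnessSpace.IsMetricSubspace X ρ) :
    TotallyBounded (Set.univ : Set X) ∧ ApartnessSpace.Precompact X := by
  have htb := hρ.totallyBounded hpre hef hX
  have : Nonempty X := by
    obtain ⟨y⟩ := ‹Nonempty Y›
    obtain ⟨x, hx, -⟩ := isDense_iff.1 hX ∅ y (mem_acompl_empty y)
    exact ⟨⟨x, hx⟩⟩
  exact ⟨htb, hρ.precompact htb⟩
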